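/- Let $\mathcal{H}_1$ and $\mathcal{H}_2$ be complex Hilbert spaces and, for $i=1,2$, let $T_i$ be an unbounded (that is, densely defined and not necessarily bounded) self-adjoint operator on $\mathcal{H}_i$ with domain $D(T_i)$. Suppose that there are linear isometries (not assumed surjective) $U_1:\mathcal{H}_1\to\mathcal{H}_2$ and $U_2:\mathcal{H}_2\to\mathcal{H}_1$ such that $U_1T_1\subseteq T_2U_1$ and $U_2T_2\subseteq T_1U_2$, where products of operators carry their natural domains and $\subseteq$ denotes extension of operators; that is, for every $x\in D(T_1)$ we have $U_1x\in D(T_2)$ and $T_2U_1x=U_1T_1x$, and likewise with the indices $1$ and $2$ interchanged. Then $T_1$ and $T_2$ are unitarily equivalent: there is a unitary transformation $U:\mathcal{H}_1\to\mathcal{H}_2$ such that $UT_1U^{-1}=T_2$ (including equality of domains, $U(D(T_1))=D(T_2)$). -/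

import Mathlib

/-- The composition `T A` of a partially defined operator `T` with an everywhere defined linear
map `A`, on its natural domain `{x | A x ∈ D(T)}`. The composition `A T` in the other order, with
domain `D(T)`, is Mathlib's `LinearMap.compPMap`. -/
def LinearPMap.compLinearMap {E F G : Type*}
    [AddCommGroup E] [Module ℂ E] [AddCommGroup F] [Module ℂ F] [AddCommGroup G] [Module ℂ G]
    (T : F →ₗ.[ℂ] G) (A : E →ₗ[ℂ] F) : E →ₗ.[ℂ] G where
  domain := T.domain.comap A
  toFun := T.toFun ∘ₗ A.restrict (p := T.domain.comap A) (q := T.domain) (fun _ hx => hx)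

/-!
This is the Cantor–Schröder–Bernstein argument, carried out for operators. Passing to adjoints
shows that `U₁†` and `U₂†` carry the graphs of `T₂` and `T₁` into each other as well, because the
`Tᵢ` are self-adjoint (`LinearPMap.Intertwines.adjoint`); no spectral theory is needed. Since the
`Tᵢ` are closed, operators respecting the graphs are stable under sums, products, adjoints and
strong limits.

Put `V = U₂ U₁` and `E = 1 - U₂ U₂†`, the projection onto the complement of the range of `U₂`.
The ranges of `E, V E, V² E, …` are mutually orthogonal, and the projection `P` onto their closed
span is the strong limit of the iterates of `Q ↦ E + V Q V†`, hence respects the graph of `T₁` and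
satisfies `P = E + V P V†` (`exists_tendsto_wanderingProj`). As in the set-theoretic proof,
the operator equal to `U₁` on the range of `P` and to `U₂†` on its orthogonal complement, namely
`U₁ P + U₂† (1 - P)`, is then unitary, and it respects the graphs, as does its inverse.
-/

open Filter Topology
open scoped InnerProduct

/-! ### Bounded operators respecting the graphs of two partial operators -/

section Intertwines

variable {𝕜 E F G : Type*} [RCLike 𝕜]
  [NormedAddCommGroup E] [InnerProductSpace 𝕜 E]
  [NormedAddCommGroup F] [InnerProductSpace 𝕜 F]
  [NormedAddCommGroup G] [InnerProductSpace 𝕜 G]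

namespace LinearPMap

/-- The bounded operator `A` intertwines `S` and `T`, that is `A S ⊆ T A`: it maps `D(S)` into
`D(T)`, with `T A x = A S x` there. Stated on graphs. -/
def Intertwines (S : E →ₗ.[𝕜] E) (T : F →ₗ.[𝕜] F) (A : E →L[𝕜] F) : Prop :=
  ∀ x y, (x, y) ∈ S.graph → (A x, A y) ∈ T.graph

namespace Intertwines

variable {S : E →ₗ.[𝕜] E} {T : F →ₗ.[𝕜] F} {R : G →ₗ.[𝕜] G}

theorem id (S : E →ₗ.[𝕜] E) : Intertwines S S 1 := fun _ _ h => h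

theorem zero (S : E →ₗ.[𝕜] E) (T : F →ₗ.[𝕜] F) : Intertwines S T 0 :=
  fun _ _ _ => T.graph.zero_mem

theorem comp {B : F →L[𝕜] G} {A : E →L[𝕜] F} (hB : Intertwines T R B) (hA : Intertwines S T A) :
    Intertwines S R (B ∘L A) := fun x y h => hB _ _ (hA x y h)

theorem add {A B : E →L[𝕜] F} (hA : Intertwines S T A) (hB : Intertwines S T B) :
    Intertwines S T (A + B) := fun x y h => T.graph.add_mem (hA x y h) (hB x y h)

theorem sub {A B : E →L[𝕜] F} (hA : Intertwines S T A) (hB : Intertwines S T B) :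
    Intertwines S T (A - B) := fun x y h => T.graph.sub_mem (hA x y h) (hB x y h)

/-- An intertwiner of self-adjoint operators has an intertwining adjoint: `A S ⊆ T A` gives
`A† T† ⊆ S† A†`. -/
theorem adjoint [CompleteSpace E] [CompleteSpace F] {A : E →L[𝕜] F} (hS : IsSelfAdjoint S)
    (hT : IsSelfAdjoint T) (hA : Intertwines S T A) : Intertwines T S A.adjoint := by
  have eS : S.graph.adjoint = S.graph := by
    rw [← adjoint_graph_eq_graph_adjoint hS.dense_domain, isSelfAdjoint_def.mp hS]
  have eT : T.graph.adjoint = T.graph := by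
    rw [← adjoint_graph_eq_graph_adjoint hT.dense_domain, isSelfAdjoint_def.mp hT]
  intro x y h
  rw [← eT, Submodule.mem_adjoint_iff] at h
  rw [← eS, Submodule.mem_adjoint_iff]
  intro a b hab
  simpa only [ContinuousLinearMap.adjoint_inner_right] using h _ _ (hA a b hab)

theorem of_tendsto {ι : Type*} {l : Filter ι} [l.NeBot] {A : ι → E →L[𝕜] F} {B : E →L[𝕜] F}
    (hT : T.IsClosed) (hA : ∀ i, Intertwines S T (A i))
    (hlim : ∀ x, Tendsto (fun i => A i x) l (𝓝 (B x))) : Intertwines S T B := fun x y h =>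
  hT.mem_of_tendsto ((hlim x).prodMk_nhds (hlim y)) (Eventually.of_forall fun i => hA i x y h)

end Intertwines

end LinearPMap

end Intertwines

theorem LinearPMap.intertwines_of_compPMap_le {E F : Type*}
    [NormedAddCommGroup E] [InnerProductSpace ℂ E] [NormedAddCommGroup F] [InnerProductSpace ℂ F]
    {S : E →ₗ.[ℂ] E} {T : F →ₗ.[ℂ] F} {U : E →ₗᵢ[ℂ] F}
    (h : U.toLinearMap.compPMap S ≤ T.compLinearMap U.toLinearMap) :
    Intertwines S T U.toContinuousLinearMap := by
  intro x y hxy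
  rw [mem_graph_iff] at hxy
  obtain ⟨x, rfl, rfl⟩ := hxy
  have hx : U x ∈ T.domain := h.1 x.2
  have e : U (S x) = T ⟨U x, hx⟩ := h.2 (x := x) (y := ⟨x, hx⟩) rfl
  exact (mem_graph_iff T).2 ⟨⟨U x, hx⟩, rfl, e.symm⟩

/-! ### The projection onto the closed span of the translates of a wandering subspace -/

section Wandering

variable {𝕜 H : Type*} [RCLike 𝕜] [NormedAddCommGroup H] [InnerProductSpace 𝕜 H] [CompleteSpace H]

/-- The iterates of `Q ↦ E + V Q V†` from `0`. For an isometry `V` and a projection `E` with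
`E V = 0`, the `n`-th one is the projection onto the sum of the ranges of `Vᵏ E`, `k < n`. -/
noncomputable def wanderingProj (V E : H →L[𝕜] H) : ℕ → (H →L[𝕜] H)
  | 0 => 0
  | n + 1 => E + V * wanderingProj V E n * star V

variable {V E : H →L[𝕜] H}

theorem isStarProjection_wanderingProj (hV : star V * V = 1) (hE : IsStarProjection E)
    (hEV : E * V = 0) (n : ℕ) : IsStarProjection (wanderingProj V E n) := by
  induction n with
  | zero => exact .zero _
  | succ n ih =>
    refine hE.add ⟨?_, ?_⟩ ?_
    · calc V * wanderingProj V E n * star V * (V * wanderingProj V E n * star V)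
          = V * (wanderingProj V E n * (star V * V) * wanderingProj V E n) * star V := by noncomm_ring
        _ = _ := by rw [hV, mul_one, ih.isIdempotentElem.eq]
    · exact ih.isSelfAdjoint.conjugate V
    · simp only [← mul_assoc, hEV, zero_mul]

theorem wanderingProj_succ_mul_self (hV : star V * V = 1) (hE : IsStarProjection E)
    (hEV : E * V = 0) (n : ℕ) :
    wanderingProj V E (n + 1) * wanderingProj V E n = wanderingProj V E n := by
  have hVE : star V * E = 0 := by
    simpa [hE.isSelfAdjoint.star_eq] using congrArg star hEV
  induction n with
  | zero => simp [wanderingProj]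
  | succ n ih =>
    set P := wanderingProj V E (n + 1) with hP
    set Q := wanderingProj V E n with hQ
    calc (E + V * P * star V) * (E + V * Q * star V)
        = E * E + E * V * Q * star V + V * P * (star V * E)
          + V * (P * (star V * V) * Q) * star V := by noncomm_ring
      _ = E + V * Q * star V := by
        rw [hE.isIdempotentElem.eq, hEV, hVE, hV, mul_one, ih]; simp

/-- The projections `wanderingProj V E n` increase, hence converge strongly to a projection. -/
theorem exists_tendsto_wanderingProj (hV : star V * V = 1) (hE : IsStarProjection E)
    (hEV : E * V = 0) :
    ∃ P : H →L[𝕜] H, IsStarProjection P ∧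
      (∀ x, Tendsto (fun n => wanderingProj V E n x) atTop (𝓝 (P x))) ∧
      P = E + V * P * star V := by
  have hproj n := isStarProjection_iff_eq_starProjection_range.mp
    (isStarProjection_wanderingProj hV hE hEV n)
  choose hcompl heq using hproj
  have hmono : Monotone fun n => (wanderingProj V E n).range := by
    refine monotone_nat_of_le_succ fun n => ?_
    rintro _ ⟨x, rfl⟩
    exact ⟨wanderingProj V E n x, congr($(wanderingProj_succ_mul_self hV hE hEV n) x)⟩
  have hlim (x : H) : Tendsto (fun n => wanderingProj V E n x) atTop
      (𝓝 ((⨆ n, (wanderingProj V E n).range).topologicalClosure.starProjection x)) := by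
    refine (Submodule.starProjection_tendsto_closure_iSup _ hmono x).congr fun n => ?_
    exact congr($((heq n).symm) x)
  refine ⟨_, isStarProjection_starProjection, hlim, ?_⟩
  ext x
  refine tendsto_nhds_unique ((hlim x).comp (tendsto_add_atTop_nat 1)) ?_
  exact (((V.continuous.tendsto _).comp (hlim (star V x))).const_add (E x))

end Wandering

/-! ### The Cantor–Schröder–Bernstein unitary -/

section SchroederBernstein

variable {𝕜 H K : Type*} [RCLike 𝕜]
  [NormedAddCommGroup H] [InnerProductSpace 𝕜 H] [CompleteSpace H]
  [NormedAddCommGroup K] [InnerProductSpace 𝕜 K] [CompleteSpace K]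

/-- A projection `P` with `1 - P = B (1 - A P A†) B†` glues the isometry `A` on the range of `P`
with `B†` on its complement to a unitary. -/
theorem exists_linearIsometryEquiv_of_proj (A : H →ₗᵢ[𝕜] K) (B : K →ₗᵢ[𝕜] H) {P : H →L[𝕜] H}
    (hP : IsStarProjection P)
    (h : ∀ x, P x = x - B (B.toContinuousLinearMap.adjoint x) +
      B (A (P (A.toContinuousLinearMap.adjoint (B.toContinuousLinearMap.adjoint x))))) :
    ∃ U : H ≃ₗᵢ[𝕜] K, U.toContinuousLinearEquiv.toContinuousLinearMap =
      A.toContinuousLinearMap ∘L P + B.toContinuousLinearMap.adjoint ∘L (1 - P) := by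
  set A' := A.toContinuousLinearMap.adjoint
  set B' := B.toContinuousLinearMap.adjoint
  have hA (x : H) : A' (A x) = x := congr($(A.adjoint_comp_self) x)
  have hB (y : K) : B' (B y) = y := congr($(B.adjoint_comp_self) y)
  have hPP (x : H) : P (P x) = P x := congr($(hP.isIdempotentElem.eq) x)
  have hPB (y : K) : P (B y) = B (A (P (A' y))) := by rw [h, hB, sub_self, zero_add]
  have hBP (x : H) : B' (P x) = A (P (A' (B' x))) := by
    rw [h x, map_add, map_sub, hB, sub_self, zero_add, hB]
  have hPAB (x : H) : P (A' (B' x)) = A' (B' (P x)) := by rw [hBP, hA]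
  set W := A.toContinuousLinearMap ∘L P + B' ∘L (1 - P) with hW
  have hW_apply (x : H) : W x = A (P x) + (B' x - B' (P x)) := by simp [hW]
  have hadj : W.adjoint = P ∘L A' + (1 - P) ∘L B.toContinuousLinearMap := by
    have hPs : P.adjoint = P := hP.isSelfAdjoint.adjoint_eq
    have h1 : (1 - P).adjoint = 1 - P := hP.one_sub.isSelfAdjoint.adjoint_eq
    rw [hW, map_add, ContinuousLinearMap.adjoint_comp, ContinuousLinearMap.adjoint_comp, hPs, h1,
      ContinuousLinearMap.adjoint_adjoint]
  have hadj_apply (y : K) : W.adjoint y = P (A' y) + (B y - P (B y)) := by simp [hadj]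
  have hWW : W.adjoint ∘L W = 1 := by
    ext x
    have hBB : B (B' x - B' (P x)) = x - P x := by
      rw [hBP, map_sub, h x]
      abel
    have hzero : P (A' (B' x - B' (P x))) = 0 := by
      rw [map_sub, map_sub, hPAB, hPAB, hPP, sub_self]
    change W.adjoint (W x) = x
    rw [hadj_apply, hW_apply, map_add, map_add, hA, hzero, map_add, hBB, map_add, map_sub, hPP,
      hPB, hA, hPP]
    abel
  have hnorm := W.norm_map_iff_adjoint_comp_self.mpr hWW
  have hsurj : Function.Surjective W := fun y => ⟨W.adjoint y, by
    simp only [hadj_apply, hW_apply, map_add, map_sub, hB, hPB, hPP, hA]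
    abel⟩
  exact ⟨.ofSurjective ⟨W.toLinearMap, hnorm⟩ hsurj, rfl⟩

end SchroederBernstein

/-- If a unitary and its inverse both intertwine `S` and `T`, then `U S U⁻¹ = T`. -/
theorem LinearPMap.compPMap_compLinearMap_symm_eq {E F : Type*}
    [NormedAddCommGroup E] [InnerProductSpace ℂ E] [NormedAddCommGroup F] [InnerProductSpace ℂ F]
    {S : E →ₗ.[ℂ] E} {T : F →ₗ.[ℂ] F} (U : E ≃ₗᵢ[ℂ] F)
    (h : Intertwines S T U.toContinuousLinearEquiv.toContinuousLinearMap)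
    (h' : Intertwines T S U.symm.toContinuousLinearEquiv.toContinuousLinearMap) :
    (U.toLinearEquiv.toLinearMap.compPMap S).compLinearMap
      U.symm.toLinearEquiv.toLinearMap = T := by
  refine LinearPMap.ext (Submodule.ext fun y => ⟨fun hy => ?_, fun hy => ?_⟩) fun y hy hy' => ?_
  · have := mem_domain_of_mem_graph (h _ _ (S.mem_graph ⟨U.symm y, hy⟩))
    simpa using this
  · have : U.symm y ∈ S.domain := mem_domain_of_mem_graph (h' _ _ (T.mem_graph ⟨y, hy⟩))
    exact this
  · have := h _ _ (S.mem_graph ⟨U.symm y, hy⟩)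
    refine T.mem_graph_snd_inj this (T.mem_graph ⟨y, hy'⟩) ?_
    simp

theorem theorem3p1
    {H₁ : Type*} [NormedAddCommGroup H₁] [InnerProductSpace ℂ H₁] [CompleteSpace H₁]
    {H₂ : Type*} [NormedAddCommGroup H₂] [InnerProductSpace ℂ H₂] [CompleteSpace H₂]
    (T₁ : H₁ →ₗ.[ℂ] H₁) (T₂ : H₂ →ₗ.[ℂ] H₂)
    (hT₁ : IsSelfAdjoint T₁) (hT₂ : IsSelfAdjoint T₂)
    (U₁ : H₁ →ₗᵢ[ℂ] H₂) (U₂ : H₂ →ₗᵢ[ℂ] H₁)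
    (h₁ : U₁.toLinearMap.compPMap T₁ ≤ T₂.compLinearMap U₁.toLinearMap)
    (h₂ : U₂.toLinearMap.compPMap T₂ ≤ T₁.compLinearMap U₂.toLinearMap) :
    ∃ U : H₁ ≃ₗᵢ[ℂ] H₂,
      (U.toLinearEquiv.toLinearMap.compPMap T₁).compLinearMap
        U.symm.toLinearEquiv.toLinearMap = T₂ := by
  have i₁ := LinearPMap.intertwines_of_compPMap_le h₁
  have i₂ := LinearPMap.intertwines_of_compPMap_le h₂
  have e₁ := U₁.adjoint_comp_self
  have e₂ := U₂.adjoint_comp_self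
  set A := U₁.toContinuousLinearMap
  set B := U₂.toContinuousLinearMap
  have j₁ := i₁.adjoint hT₁ hT₂
  have j₂ := i₂.adjoint hT₂ hT₁
  have hA (x : H₁) : A.adjoint (A x) = x := congr($e₁ x)
  have hB (y : H₂) : B.adjoint (B y) = y := congr($e₂ y)
  set V : H₁ →L[ℂ] H₁ := B ∘L A with hV_def
  set E : H₁ →L[ℂ] H₁ := 1 - B ∘L B.adjoint with hE_def
  have hVs : star V = A.adjoint ∘L B.adjoint := ContinuousLinearMap.adjoint_comp B A
  have hV : star V * V = 1 := by
    rw [hVs]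
    ext x
    simp [hV_def, hA, hB]
  have hE : IsStarProjection E := by
    refine IsStarProjection.one_sub ⟨?_, ?_⟩
    · ext x
      simp [hB]
    · rw [ContinuousLinearMap.isSelfAdjoint_iff', ContinuousLinearMap.adjoint_comp,
        ContinuousLinearMap.adjoint_adjoint]
  have hEV : E * V = 0 := by
    ext x
    simp [hE_def, hV_def, hB]
  obtain ⟨P, hP, hlim, hfix⟩ := exists_tendsto_wanderingProj hV hE hEV
  have iE : LinearPMap.Intertwines T₁ T₁ E := (LinearPMap.Intertwines.id T₁).sub (i₂.comp j₂)
  have iPn (n : ℕ) : LinearPMap.Intertwines T₁ T₁ (wanderingProj V E n) := by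
    induction n with
    | zero => exact .zero _ _
    | succ n ih =>
      refine iE.add (((i₂.comp i₁).comp ih).comp ?_)
      rw [hVs]
      exact j₁.comp j₂
  have iP : LinearPMap.Intertwines T₁ T₁ P := .of_tendsto hT₁.isClosed iPn hlim
  obtain ⟨U, hU⟩ := exists_linearIsometryEquiv_of_proj U₁ U₂ hP fun x => by
    conv_lhs => rw [hfix]
    simp only [hVs]
    rfl
  have iU : LinearPMap.Intertwines T₁ T₂ U.toContinuousLinearEquiv.toContinuousLinearMap := by
    rw [hU]
    exact (i₁.comp iP).add (j₂.comp ((LinearPMap.Intertwines.id T₁).sub iP))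
  refine ⟨U, LinearPMap.compPMap_compLinearMap_symm_eq U iU ?_⟩
  have := iU.adjoint hT₁ hT₂
  rwa [show (U.toContinuousLinearEquiv.toContinuousLinearMap).adjoint = _ from
    U.adjoint_eq_symm] at this
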